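/- **Conventions.** Alphabets are finite sets. $A^*$, $A^+$, $A^\omega$ are the sets of finite, nonempty finite, and infinite words over $A$; languages are subsets of $A^*$, $\omega$-languages are subsets of $A^\omega$. A class of languages (resp. $\omega$-languages) assigns to each alphabet $A$ a set $\mathcal C(A)$ of languages (resp. $\omega$-languages) over $A$. A class $\mathcal C$ of $\omega$-languages is a *lattice* if each $\mathcal C(A)$ contains $\emptyset$ and $A^\omega$ and is closed under $\cup$ and $\cap$; it is *closed under inverse image* if for all alphabets $A,B$, every monoid morphism $\varphi:A^*\to B^*$ (possibly erasing letters) and every $L\in\mathcal C(B)$, the set of $w=a_0a_1a_2\cdots\in A^\omega$ such that $\varphi(a_0)\varphi(a_1)\varphi(a_2)\cdots$ is infinite and belongs to $L$ is in $\mathcal C(A)$. **Covering.** For an $\omega$-language $L\subseteq A^\omega$ and a finite multiset $\mathbf L$ of $\omega$-languages over $A$, the pair $(L,\mathbf L)$ is *$\mathcal C$-coverable* if there is a finite set $\mathbf K\subseteq\mathcal C(A)$ with $L\subseteq\bigcup_{K\in\mathbf K}K$ such that for each $K\in\mathbf K$ there is $L'\in\mathbf L$ with $K\cap L'=\emptyset$.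 **Enrichment.** $\mathrm{SU}(A)$ (resp. $\mathrm{SU}_k(A)$) consists of the finite Boolean combinations of languages $A^*w$ with $w\in A^*$ (resp. with moreover $|w|\le k$). For a finite partition $\mathbf P$ of $A^*$ and $w=a_1a_2\cdots\in A^\omega$, let $\tau_{\mathbf P}(w)\in(\mathbf P\times A)^\omega$ be the infinite word whose $i$-th letter is $(P_i,a_i)$, where $P_i\in\mathbf P$ contains $a_1\cdots a_{i-1}$. For a class $\mathcal C$ of $\omega$-languages and a class $\mathcal D$ of languages, $(\mathcal C\circ\mathcal D)(A)$ consists of all $\tau_{\mathbf P}^{-1}(L)$ where $\mathbf P$ is a finite partition of $A^*$ into languages of $\mathcal D(A)$ and $L\in\mathcal C(\mathbf P\times A)$. **Well-formed words.** An $\omega$-semigroup $(S_+,S_\omega)$ is a semigroup $S_+$ and a set $S_\omega$ with a mixed product $S_+\times S_\omega\to S_\omega$ and an infinite product $(S_+)^\omega\to S_\omega$ satisfying all associativity laws; it is finite if $S_+$ and $S_\omega$ are; $(A^+,A^\omega)$ is one under concatenation, and morphisms preserve all products. Let $\alpha:(A^+,A^\omega)\to(S_+,S_\omega)$ be a morphism.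 An $\omega$-language $L\subseteq A^\omega$ is *recognized* by $\alpha$ if $L=\alpha^{-1}(F)$ for some $F\subseteq S_\omega$. Let $S=\alpha(A^+)$, let $E(S)$ be its set of idempotents, and $\square\notin S$. The alphabet of well-formed words is $\mathbb A_\alpha=(E(S)\cup\{\square\})\times S\times E(S)$. A word of $\mathbb A_\alpha^\omega$ is *well-formed* if it has the form $(\square,s_0,e_1)(e_1,s_1,e_2)(e_2,s_2,e_3)\cdots$. Let $\mathrm{eval}:(\mathbb A_\alpha^+,\mathbb A_\alpha^\omega)\to(S_+,S_\omega)$ be the morphism with $\mathrm{eval}((e,s,f))=esf$ and $\mathrm{eval}((\square,s,f))=sf$. For $L$ recognized by $\alpha$, put $L_\alpha^{\mathrm{wf}}=\{w\in\mathbb A_\alpha^\omega : w\text{ is well-formed and }\mathrm{eval}(w)\in\alpha(L)\}$, and for a multiset $\mathbf L$ of such languages let $\mathbf L_\alpha^{\mathrm{wf}}$ be the multiset of all $L'^{\,\mathrm{wf}}_\alpha$, $L'\in\mathbf L$. **Theorem 7.1.** Let $\alpha:(A^+,A^\omega)\to(S_+,S_\omega)$ be a morphism into a finite $\omega$-semigroup,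 and let $\mathcal C$ be a lattice of $\omega$-languages closed under inverse image. Let $L$ be an $\omega$-language and $\mathbf L$ a finite multiset of $\omega$-languages over $A$, all recognized by $\alpha$. Then the following are equivalent: 1. $(L,\mathbf L)$ is $(\mathcal C\circ\mathrm{SU})$-coverable; 2. $(L,\mathbf L)$ is $(\mathcal C\circ\mathrm{SU}_n)$-coverable, where $n=2^{3|S_+|+1}$; 3. $(L_\alpha^{\mathrm{wf}},\mathbf L_\alpha^{\mathrm{wf}})$ is $\mathcal C$-coverable. -/

import Mathlib

universe u v

namespace OmegaEnrich

/-! ## Finite and infinite words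

Finite words over `A` are elements of `List A`, nonempty finite words are elements of
`FreeSemigroup A`, and infinite words are maps `ℕ → A` (the letter at position `n` is `w n`). -/

section Words

variable {A : Type u}

/-- The prefix of length `n` of the infinite word `w`. -/
def wordPrefix (w : ℕ → A) (n : ℕ) : List A := (List.range n).map w

/-- The concatenation `u 0 ⬝ u 1 ⬝ ⋯ ⬝ u (n - 1)`. -/
def concatFirst (u : ℕ → List A) (n : ℕ) : List A := (List.range n).flatMap u

/-- The infinite concatenation `u 0 ⬝ u 1 ⬝ u 2 ⬝ ⋯` of finite words is the infinite word `w`: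
infinitely many factors are nonempty, and every finite concatenation is a prefix of `w`. -/
def IsInfiniteConcat (u : ℕ → List A) (w : ℕ → A) : Prop :=
  (∀ N, ∃ n, N ≤ n ∧ u n ≠ []) ∧
    ∀ n, concatFirst u n = wordPrefix w (concatFirst u n).length

/-- A nonempty word seen as a list. -/
def toWord (u : FreeSemigroup A) : List A := u.head :: u.tail

/-- The concatenation of a nonempty finite word with an infinite word. -/
def appendOmega (u : FreeSemigroup A) (w : ℕ → A) : ℕ → A := fun n =>
  if h : n < (toWord u).length then (toWord u)[n] else w (n - (toWord u).length)

theorem concatFirst_succ (u : ℕ → List A) (n : ℕ) :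
    concatFirst u (n + 1) = concatFirst u n ++ u n := by
  simp [concatFirst, List.range_succ]

theorem length_concatFirst_ge (u : ℕ → FreeSemigroup A) (n : ℕ) :
    n ≤ (concatFirst (fun i => toWord (u i)) n).length := by
  induction n with
  | zero => simp
  | succ n ih =>
    rw [concatFirst_succ, List.length_append]
    exact Nat.add_le_add ih (Nat.succ_le_succ (Nat.zero_le _))

/-- The infinite concatenation of a sequence of nonempty finite words. -/
def omegaConcat (u : ℕ → FreeSemigroup A) : ℕ → A := fun n =>
  (concatFirst (fun i => toWord (u i)) (n + 1))[n]'(length_concatFirst_ge u (n + 1))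

theorem concatFirst_prefix (u : ℕ → List A) {m n : ℕ} (h : m ≤ n) :
    concatFirst u m <+: concatFirst u n := by
  induction n, h using Nat.le_induction with
  | base => exact List.prefix_rfl
  | succ n _ ih => rw [concatFirst_succ]; exact ih.trans (List.prefix_append _ _)

theorem wordPrefix_length (w : ℕ → A) (n : ℕ) : (wordPrefix w n).length = n := by
  simp [wordPrefix]

theorem omegaConcat_spec (u : ℕ → FreeSemigroup A) :
    IsInfiniteConcat (fun i => toWord (u i)) (omegaConcat u) := by
  refine ⟨fun N => ⟨N, le_rfl, by simp [toWord]⟩, fun n => ?_⟩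
  refine List.ext_getElem (by simp [wordPrefix]) fun i h1 h2 => ?_
  have h3 : i < (concatFirst (fun i => toWord (u i)) (i + 1)).length :=
    length_concatFirst_ge u (i + 1)
  simp only [wordPrefix, List.getElem_map, List.getElem_range, omegaConcat]
  rcases le_total n (i + 1) with h | h
  · exact (concatFirst_prefix _ h).getElem h1
  · exact ((concatFirst_prefix _ h).getElem h3).symm

theorem length_concatFirst_unbounded {u : ℕ → List A} (hu : ∀ N, ∃ n, N ≤ n ∧ u n ≠ []) (N : ℕ) :
    ∃ n, N ≤ (concatFirst u n).length := by
  induction N with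
  | zero => exact ⟨0, Nat.zero_le _⟩
  | succ N ih =>
    obtain ⟨n, hn⟩ := ih
    obtain ⟨m, hm, hm'⟩ := hu n
    refine ⟨m + 1, ?_⟩
    have h1 := (concatFirst_prefix u hm).length_le
    have h2 := List.length_pos_iff.2 hm'
    rw [concatFirst_succ, List.length_append]
    omega

/-- An infinite concatenation is unique. -/
theorem IsInfiniteConcat.unique {u : ℕ → List A} {w w' : ℕ → A}
    (h : IsInfiniteConcat u w) (h' : IsInfiniteConcat u w') : w = w' := by
  funext i
  obtain ⟨n, hn⟩ := length_concatFirst_unbounded h.1 (i + 1)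
  have h1 := (h.2 n).symm.trans (h'.2 n)
  simp only [wordPrefix, List.map_inj_left, List.mem_range] at h1
  exact h1 i hn

end Words

/-! ## ω-semigroups -/

/-- The product `s i * s (i + 1) * ⋯ * s (i + n)` in a semigroup. -/
def blockProd {S : Type u} [Semigroup S] (s : ℕ → S) (i : ℕ) : ℕ → S
  | 0 => s i
  | n + 1 => blockProd s i n * s (i + n + 1)

/-- `(S, T)` is an ω-semigroup: a semigroup `S`, a set `T`, a mixed product `S × T → T`, and an
infinite product `S^ω → T`, subject to all the associativity laws. -/
class OmegaSemigroup (S : Type u) (T : Type v) [Semigroup S] where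
  /-- the mixed product -/
  mixed : S → T → T
  /-- the infinite product `s 0 * s 1 * s 2 * ⋯` -/
  infProd : (ℕ → S) → T
  mul_mixed : ∀ (s s' : S) (t : T), mixed (s * s') t = mixed s (mixed s' t)
  mixed_infProd : ∀ (s : S) (f : ℕ → S),
    mixed s (infProd f) = infProd (fun n => Nat.casesOn n s f)
  /-- Cutting a sequence into consecutive nonempty blocks `[k i, k (i + 1))` and multiplying out
  the blocks does not change the infinite product. -/
  infProd_blocks : ∀ (f : ℕ → S) (k : ℕ → ℕ), StrictMono k → k 0 = 0 →
    infProd (fun i => blockProd f (k i) (k (i + 1) - k i - 1)) = infProd f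

section FreeOmega

variable {A : Type u}

theorem toWord_mul (x y : FreeSemigroup A) : toWord (x * y) = toWord x ++ toWord y := rfl

theorem appendOmega_prefix (x : FreeSemigroup A) (w : ℕ → A) (n : ℕ) :
    wordPrefix (appendOmega x w) ((toWord x).length + n) = toWord x ++ wordPrefix w n := by
  refine List.ext_getElem (by simp [wordPrefix]) fun i h1 h2 => ?_
  simp only [wordPrefix, List.getElem_map, List.getElem_range, appendOmega, List.getElem_append]

theorem concatFirst_cons (x : List A) (f : ℕ → List A) (n : ℕ) :
    concatFirst (fun n => Nat.casesOn n x f) (n + 1) = x ++ concatFirst f n := by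
  simp [concatFirst, List.range_succ_eq_map, List.flatMap_map]

theorem toWord_blockProd (f : ℕ → FreeSemigroup A) (i n : ℕ) :
    concatFirst (fun j => toWord (f j)) i ++ toWord (blockProd f i n) =
      concatFirst (fun j => toWord (f j)) (i + n + 1) := by
  induction n with
  | zero => rw [Nat.add_zero, concatFirst_succ]; rfl
  | succ n ih =>
    rw [blockProd, toWord_mul, ← List.append_assoc, ih]
    exact (concatFirst_succ (fun j => toWord (f j)) _).symm

/-- The ω-semigroup `(A⁺, A^ω)` of all nonempty finite words and all infinite words over `A`. -/
instance freeOmegaSemigroup : OmegaSemigroup (FreeSemigroup A) (ℕ → A) where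
  mixed := appendOmega
  infProd := omegaConcat
  mul_mixed x y w := by
    funext n
    simp only [appendOmega, toWord_mul, List.length_append, List.getElem_append]
    split_ifs <;> first | rfl | omega | (congr 1; omega)
  mixed_infProd x f := by
    refine IsInfiniteConcat.unique (u := fun n => Nat.casesOn n (toWord x) fun i => toWord (f i))
      ⟨fun N => ⟨N + 1, by omega, by simp [toWord]⟩, fun n => ?_⟩ ?_
    · cases n with
      | zero => rfl
      | succ n =>
        rw [concatFirst_cons, List.length_append, appendOmega_prefix, ← (omegaConcat_spec f).2 n]
    · convert omegaConcat_spec (fun n => Nat.casesOn n x f : ℕ → FreeSemigroup A) using 2 with n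
      cases n <;> rfl
  infProd_blocks f k hk hk0 := by
    set g : ℕ → FreeSemigroup A := fun i => blockProd f (k i) (k (i + 1) - k i - 1)
    have key : ∀ n, concatFirst (fun i => toWord (g i)) n =
        concatFirst (fun i => toWord (f i)) (k n) := by
      intro n
      induction n with
      | zero => rw [hk0]; rfl
      | succ n ih =>
        have := hk (Nat.lt_succ_self n)
        rw [concatFirst_succ, ih, toWord_blockProd]
        congr 1
        simp only [Nat.succ_eq_add_one] at this
        omega
    refine (omegaConcat_spec g).unique ⟨fun N => ⟨N, le_rfl, by simp [toWord]⟩, fun n => ?_⟩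
    rw [key]
    exact (omegaConcat_spec f).2 (k n)

end FreeOmega

/-- Morphisms of ω-semigroups. -/
structure OmegaHom (S : Type*) (T : Type*) (S' : Type*) (T' : Type*)
    [Semigroup S] [OmegaSemigroup S T] [Semigroup S'] [OmegaSemigroup S' T'] where
  /-- the action on finite products -/
  fin : S →ₙ* S'
  /-- the action on infinite products -/
  inf : T → T'
  map_mixed : ∀ (s : S) (t : T),
    inf (OmegaSemigroup.mixed s t) = OmegaSemigroup.mixed (fin s) (inf t)
  map_infProd : ∀ f : ℕ → S,
    inf (OmegaSemigroup.infProd f) = OmegaSemigroup.infProd fun n => fin (f n)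

/-! ## Classes of languages -/

/-- A class of languages of finite words: a set of languages over each (finite) alphabet. -/
def LangClass : Type (u + 1) := ∀ (A : Type u) [Finite A], Set (Set (List A))

/-- A class of ω-languages: a set of ω-languages over each (finite) alphabet. -/
def OmegaClass : Type (u + 1) := ∀ (A : Type u) [Finite A], Set (Set (ℕ → A))

/-- The class is closed under finite unions and finite intersections, including empty ones. -/
structure OmegaClass.IsLattice (C : OmegaClass.{u}) : Prop where
  empty_mem : ∀ (A : Type u) [Finite A], ∅ ∈ C A
  univ_mem : ∀ (A : Type u) [Finite A], Set.univ ∈ C A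
  union_mem : ∀ (A : Type u) [Finite A], ∀ L ∈ C A, ∀ L' ∈ C A, L ∪ L' ∈ C A
  inter_mem : ∀ (A : Type u) [Finite A], ∀ L ∈ C A, ∀ L' ∈ C A, L ∩ L' ∈ C A

/-- The inverse image of an ω-language `L` over `B` under the map `A^∞ → B^∞` induced by a monoid
morphism `φ : A* → B*` (which may erase letters): the infinite words `w` whose image
`φ (w 0) φ (w 1) φ (w 2) ⋯` is an infinite word that belongs to `L`. -/
def inverseImage {A B : Type u} (φ : FreeMonoid A →* FreeMonoid B) (L : Set (ℕ → B)) :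
    Set (ℕ → A) :=
  {w | ∃ v ∈ L, IsInfiniteConcat (fun n => (φ (FreeMonoid.of (w n))).toList) v}

/-- Closure under inverse image of arbitrary morphisms `A* → B*`. -/
def OmegaClass.ClosedUnderInverseImage (C : OmegaClass.{u}) : Prop :=
  ∀ (A B : Type u) [Finite A] [Finite B] (φ : FreeMonoid A →* FreeMonoid B),
    ∀ L ∈ C B, inverseImage φ L ∈ C A

/-- The pair `(L, Ls)` is `C`-coverable: there is a finite set `K` of ω-languages of `C` that
covers `L` and such that each member of `K` is disjoint from some member of `Ls`. -/
def Coverable (C : OmegaClass.{u}) {A : Type u} [Finite A] (L : Set (ℕ → A))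
    (Ls : Multiset (Set (ℕ → A))) : Prop :=
  ∃ K : Set (Set (ℕ → A)), K.Finite ∧ K ⊆ C A ∧ L ⊆ ⋃₀ K ∧ ∀ H ∈ K, ∃ L' ∈ Ls, H ∩ L' = ∅

/-! ## Suffix languages -/

/-- Suffix languages: finite Boolean combinations of languages `A* w` with `w` a finite word. -/
def SU : LangClass.{u} := fun A _ =>
  {L | L ∈ BooleanSubalgebra.closure {X : Set (List A) | ∃ w : List A, X = {x | w <:+ x}}}

/-- Finite Boolean combinations of languages `A* w` with `w` a finite word of length at most
`k`. -/
def SUk (k : ℕ) : LangClass.{u} := fun A _ =>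
  {L | L ∈ BooleanSubalgebra.closure
    {X : Set (List A) | ∃ w : List A, w.length ≤ k ∧ X = {x | w <:+ x}}}

/-! ## Enrichment -/

/-- The unique member of the partition `P` that contains the word `x`. -/
noncomputable def partOf {A : Type u} {P : Set (Set (List A))} (hP : Setoid.IsPartition P)
    (x : List A) : P :=
  ⟨(hP.2 x).choose, (hP.2 x).choose_spec.1.1⟩

/-- The `P`-tagging of an infinite word `w`: the letter at each position is paired with the member
of `P` that contains the prefix of `w` strictly before that position. -/
noncomputable def tagging {A : Type u} {P : Set (Set (List A))} (hP : Setoid.IsPartition P)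
    (w : ℕ → A) : ℕ → P × A :=
  fun n => (partOf hP (wordPrefix w n), w n)

/-- The `D`-enrichment of `C`: the inverse images, under the tagging by a finite partition `P` of
the set of finite words into languages of `D`, of the ω-languages of `C` over `P × A`. -/
def enrich (C : OmegaClass.{u}) (D : LangClass.{u}) : OmegaClass.{u} := fun A _ =>
  {K | ∃ (P : Set (Set (List A))) (hP : Setoid.IsPartition P) (_ : Finite P), P ⊆ D A ∧
    ∃ L ∈ C (P × A), K = tagging hP ⁻¹' L}

/-! ## Well-formed infinite words -/

section WellFormed

variable {A S : Type u} {T : Type v} [Semigroup S] [OmegaSemigroup S T]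
  (α : OmegaHom (FreeSemigroup A) (ℕ → A) S T)

/-- `L` is recognized by the morphism `α`. -/
def Recognizes (L : Set (ℕ → A)) : Prop := ∃ F : Set T, L = α.inf ⁻¹' F

/-- The semigroup `α(A⁺)`. -/
abbrev imageS : Subsemigroup S := MulHom.srange α.fin

/-- The idempotents of `α(A⁺)`. -/
abbrev idemS : Type u := {e : imageS α // IsIdempotentElem e}

/-- The alphabet `(E ∪ {□}) × α(A⁺) × E` of well-formed ω-words, where `E` is the set of
idempotents of `α(A⁺)` and `none` plays the role of `□`. -/
abbrev WfAlphabet : Type u := Option (idemS α) × imageS α × idemS α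

/-- An infinite word is well-formed if it reads `(□, s₀, e₁) (e₁, s₁, e₂) (e₂, s₂, e₃) ⋯`. -/
def IsWellFormed (w : ℕ → WfAlphabet α) : Prop :=
  (w 0).1 = none ∧ ∀ i, (w (i + 1)).1 = some (w i).2.2

/-- The value of a letter: `e s f` for `(e, s, f)` and `s f` for `(□, s, f)`. -/
def evalLetter : WfAlphabet α → S
  | (some e, s, f) => (e.1 : S) * (s : S) * (f.1 : S)
  | (none, s, f) => (s : S) * (f.1 : S)

/-- The value in `T` of an infinite word: the infinite product of the values of its letters. -/
def evalOmega (w : ℕ → WfAlphabet α) : T := OmegaSemigroup.infProd fun n => evalLetter α (w n)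

/-- The language of well-formed ω-words associated to `L`. -/
def wfLang (L : Set (ℕ → A)) : Set (ℕ → WfAlphabet α) :=
  {w | IsWellFormed α w ∧ evalOmega α w ∈ α.inf '' L}

end WellFormed

end OmegaEnrich

/-!
The implication from `SUk` to `SU` is an inclusion of classes. The other two transport a cover along
a map between infinite words over `A` and well-formed words that preserves values; composed with a
tagging, each map is induced by a morphism of free monoids, so that closure under inverse image
applies.

*From `SU` to well-formed words.* A suffix language only sees the suffixes of length at most `k` of
a word, for some `k` (`eventually_sameSuffixes_of_mem_SU`). Fix such a `k` for all members of the
cover, choose a word `W s` of value `s` for every `s`, and a word `E e` of value `e` and of length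
at least `k` for every idempotent `e`. A letter `(e, s, f)` is sent to `E e * W s * E f`, and
`(□, s, f)` to `W s * E f`. In a well-formed word the image of `(e, s, f)` comes after an occurrence
of `E e`, which determines all its tags (`isInfiniteConcat_tagLetter`).

*From well-formed words to `SUk`.* Cut an infinite word `w` at the positions where a *minimal
idempotent word* ends: a nonempty factor whose value is idempotent, and none of whose proper
nonempty factors has an idempotent value. Every word of length at least `N = 2 ^ (3 * |S|)` has a
factor with an idempotent value (`exists_idempotent_infix`; even `2 ^ (|S| + 1)` suffices), so both
minimal idempotent words and the gaps between cuts have length at most `N`. Let `p j` be the cuts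
and `e j` the corresponding idempotents; at the cut `p (j + 1)` the letter `(e j, s, e (j + 1))` is
emitted, where `s` is the value of `w` between the two cuts. It is determined by the last `2 * N`
letters read (`Emits.of_sameSuffixes`).

The value is preserved because minimal idempotent words are incomparable for inclusion, hence start
in the order in which they end: a later one is a suffix of an earlier one followed by what separates
their ends (`MinIdemWord.suffix_append`). So `e j` followed by the value between `p j` and `p m`
absorbs `e m`, and this value alone does as soon as `p m` is at distance at least `N` from `p j`.
Regrouping the infinite product removes all inserted idempotents (`infProd_insert_at`). Absorption
by the preceding prefix alone would not be enough, since prefixes do not determine the value of an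
infinite product.
-/

namespace OmegaEnrich

/-! ### Idempotent factors of long words -/

section IdempotentFactor

variable {M : Type*} [Monoid M]

/-- In a finite monoid, an element `y` that fixes some `x` on the right and lies below `x` in the
`J`-order is idempotent: by finiteness `y = z * x` for some `z`, hence `y * y = z * x * y = y`. -/
theorem isIdempotentElem_of_mul_eq_left [Finite M] {x y a b : M} (hxy : x * y = x)
    (hy : y = a * x * b) : IsIdempotentElem y := by
  have key : ∀ n : ℕ, (a * x) ^ n * y * b ^ n = y := by
    intro n
    induction n with
    | zero => simp
    | succ n ih =>
      calc (a * x) ^ (n + 1) * y * b ^ (n + 1) = (a * x) ^ n * (a * (x * y) * b) * b ^ n := by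
            rw [pow_succ, pow_succ' b]; simp only [mul_assoc]
        _ = y := by rw [hxy, ← hy, ih]
  obtain ⟨i, j, hij, h⟩ : ∃ i j : ℕ, i < j ∧ (a * x) ^ i = (a * x) ^ j := by
    obtain ⟨i, j, hij, h⟩ := Finite.exists_ne_map_eq_of_infinite (fun n : ℕ => (a * x) ^ n)
    rcases lt_or_gt_of_ne hij with h' | h'
    · exact ⟨i, j, h', h⟩
    · exact ⟨j, i, h', h.symm⟩
  obtain ⟨m, rfl⟩ := Nat.exists_eq_add_of_lt hij
  have h1 : (a * x) ^ (m + 1) * y = y := by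
    calc (a * x) ^ (m + 1) * y = (a * x) ^ (m + 1) * ((a * x) ^ i * y * b ^ i) := by rw [key]
      _ = (a * x) ^ (i + m + 1) * y * b ^ i := by
        rw [show i + m + 1 = m + 1 + i by omega, pow_add _ (m + 1) i]; simp only [mul_assoc]
      _ = y := by rw [← h, key]
  have h2 : y = (a * x) ^ m * a * x := by
    calc y = (a * x) ^ (m + 1) * y := h1.symm
      _ = (a * x) ^ m * a * (x * y) := by rw [pow_succ]; simp only [mul_assoc]
      _ = _ := by rw [hxy]
  calc y * y = (a * x) ^ m * a * (x * y) := by rw [← mul_assoc, ← h2]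
    _ = y := by rw [hxy, ← h2]

/-- The set of elements above `x` in the `J`-order, that is, of the factors of `x`. -/
def jUpper (x : M) : Set M := {y | ∃ a b, x = a * y * b}

theorem self_mem_jUpper (x : M) : x ∈ jUpper x := ⟨1, 1, by simp⟩

theorem jUpper_trans {x y z : M} (hy : y ∈ jUpper x) (hz : z ∈ jUpper y) : z ∈ jUpper x := by
  obtain ⟨a, b, rfl⟩ := hy
  obtain ⟨c, d, rfl⟩ := hz
  exact ⟨a * c, d * b, by simp only [mul_assoc]⟩

variable {A : Type*}

theorem prod_mem_jUpper_of_infix (f : A → M) {u l : List A} (h : u <:+: l) :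
    (u.map f).prod ∈ jUpper (l.map f).prod := by
  obtain ⟨s, t, rfl⟩ := h
  exact ⟨(s.map f).prod, (t.map f).prod, by simp [mul_assoc]⟩

/-- Induction on the number `d` of factors of the value of the word `l`. If the `J`-class of this
value has `j` elements, a factor of length `2 ^ (d - j)` either has its value in that `J`-class, or
contains an idempotent factor by induction. In the first case the pigeonhole principle, applied to
the prefixes of length `(i + 1) * 2 ^ (d - j)` with `i ≤ j`, yields two that have the same value,
and the word between them has an idempotent value. -/
theorem exists_idempotent_infix_of_card_jUpper [Finite M] (f : A → M) (d : ℕ) :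
    ∀ l : List A, (jUpper (l.map f).prod).ncard ≤ d → 2 ^ d ≤ l.length →
      ∃ u, u <:+: l ∧ u ≠ [] ∧ IsIdempotentElem (u.map f).prod := by
  induction d using Nat.strong_induction_on with
  | _ d ih =>
  intro l hd hl
  by_contra! hno
  set x := (l.map f).prod with hx
  set J : Set M := {y | y ∈ jUpper x ∧ x ∈ jUpper y} with hJ
  have hxJ : x ∈ J := ⟨self_mem_jUpper x, self_mem_jUpper x⟩
  have hJpos : 0 < J.ncard := (Set.ncard_pos (Set.toFinite _)).2 ⟨x, hxJ⟩
  have hJd : J.ncard ≤ d :=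
    (Set.ncard_le_ncard (fun y hy => hy.1) (Set.toFinite _)).trans hd
  set B := 2 ^ (d - J.ncard) with hB
  have hBpos : 0 < B := by positivity
  have hlong : ∀ u, u <:+: l → B ≤ u.length → (u.map f).prod ∈ J := by
    intro u hu hlen
    by_contra hnot
    have hux := prod_mem_jUpper_of_infix f hu
    have hsub : jUpper (u.map f).prod ⊆ jUpper x \ J := fun z hz =>
      ⟨jUpper_trans hux hz, fun hzJ => hnot ⟨hux, jUpper_trans hz hzJ.2⟩⟩
    have hcard : (jUpper (u.map f).prod).ncard ≤ d - J.ncard := by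
      refine (Set.ncard_le_ncard hsub (Set.toFinite _)).trans ?_
      rw [Set.ncard_sdiff (fun y hy => hy.1) (Set.toFinite _)]
      omega
    obtain ⟨u', h1, h2, h3⟩ := ih (d - J.ncard) (by omega) u hcard hlen
    exact hno u' (h1.trans hu) h2 h3
  have hsize : (J.ncard + 1) * B ≤ l.length := by
    calc (J.ncard + 1) * B ≤ 2 ^ J.ncard * B := Nat.mul_le_mul_right _ Nat.lt_two_pow_self
      _ = 2 ^ d := by rw [hB, ← pow_add]; congr 1; omega
      _ ≤ l.length := hl
  have hpre : ∀ i : Fin (J.ncard + 1), (i.1 + 1) * B ≤ l.length := fun i =>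
    (Nat.mul_le_mul_right _ i.2).trans hsize
  have hmem : ∀ i : Fin (J.ncard + 1), ((l.take ((i.1 + 1) * B)).map f).prod ∈ J := fun i =>
    hlong _ (List.take_prefix _ _).isInfix (by
      rw [List.length_take, min_eq_left (hpre i)]; nlinarith)
  obtain ⟨i, k, hik, heq⟩ : ∃ i k : Fin (J.ncard + 1), i < k ∧
      ((l.take ((i.1 + 1) * B)).map f).prod = ((l.take ((k.1 + 1) * B)).map f).prod := by
    have : ¬ Function.Injective
        (fun i : Fin (J.ncard + 1) => (⟨_, hmem i⟩ : J)) := by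
      intro hinj
      have := Nat.card_le_card_of_injective _ hinj
      rw [Nat.card_coe_set_eq, Nat.card_eq_fintype_card, Fintype.card_fin] at this
      omega
    simp only [Function.Injective, not_forall] at this
    obtain ⟨i, k, h, hne⟩ := this
    rcases lt_or_gt_of_ne hne with h' | h'
    · exact ⟨i, k, h', congrArg Subtype.val h⟩
    · exact ⟨k, i, h', (congrArg Subtype.val h).symm⟩
  have hik' : (i.1 + 1) * B + B ≤ (k.1 + 1) * B := by
    have : i.1 + 1 + 1 ≤ k.1 + 1 := Nat.succ_le_succ hik
    nlinarith
  set y := (l.take ((k.1 + 1) * B)).drop ((i.1 + 1) * B) with hy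
  have hyl : y <:+: l := (List.drop_suffix _ _).isInfix.trans (List.take_prefix _ _).isInfix
  have hylen : B ≤ y.length := by
    rw [hy, List.length_drop, List.length_take, min_eq_left (hpre k)]
    omega
  have hsplit : l.take ((k.1 + 1) * B) = l.take ((i.1 + 1) * B) ++ y := by
    conv_lhs => rw [← List.take_append_drop ((i.1 + 1) * B) (l.take ((k.1 + 1) * B))]
    rw [List.take_take, min_eq_left (by omega)]
  obtain ⟨a, b, hab⟩ := jUpper_trans (hlong y hyl hylen).2 (hmem i).1
  refine hno y hyl (List.ne_nil_of_length_pos (by omega)) (isIdempotentElem_of_mul_eq_left ?_ hab)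
  rw [hsplit, List.map_append, List.prod_append] at heq
  exact heq.symm

/-- Every word of length at least `2 ^ |M|` over a finite monoid `M` has a nonempty factor with an
idempotent value. -/
theorem exists_idempotent_infix [Finite M] (f : A → M) {l : List A}
    (hl : 2 ^ Nat.card M ≤ l.length) :
    ∃ u, u <:+: l ∧ u ≠ [] ∧ IsIdempotentElem (u.map f).prod :=
  exists_idempotent_infix_of_card_jUpper f _ l (Set.ncard_le_card _) hl

end IdempotentFactor

/-! ### Inserting idempotents into an infinite product -/

section InfiniteProducts

variable {S : Type u} {T : Type v} [Semigroup S]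

/-- The product of the factors `f i, …, f (j - 1)`, for `i < j`. -/
def blockBetween (f : ℕ → S) (i j : ℕ) : S := blockProd f i (j - i - 1)

theorem blockBetween_succ (f : ℕ → S) {i j : ℕ} (h : i < j) :
    blockBetween f i (j + 1) = blockBetween f i j * f j := by
  obtain ⟨m, rfl⟩ := Nat.exists_eq_add_of_lt h
  simp only [blockBetween]
  rw [show i + m + 1 + 1 - i - 1 = m + 1 by omega, show i + m + 1 - i - 1 = m by omega]
  rfl

theorem blockBetween_self_succ (f : ℕ → S) (i : ℕ) : blockBetween f i (i + 1) = f i := by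
  simp [blockBetween, blockProd]

theorem blockBetween_mul (f : ℕ → S) {i j k : ℕ} (hij : i < j) (hjk : j < k) :
    blockBetween f i j * blockBetween f j k = blockBetween f i k := by
  induction k, hjk using Nat.le_induction with
  | base => rw [blockBetween_self_succ, blockBetween_succ f hij]
  | succ k hk ih =>
    rw [blockBetween_succ f hk, ← mul_assoc, ih, blockBetween_succ f (hij.trans hk)]

variable [OmegaSemigroup S T]

theorem infProd_blockBetween (f : ℕ → S) {k : ℕ → ℕ} (hk : StrictMono k) (hk0 : k 0 = 0) :
    (OmegaSemigroup.infProd (fun i => blockBetween f (k i) (k (i + 1))) : T) =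
      OmegaSemigroup.infProd f :=
  OmegaSemigroup.infProd_blocks f k hk hk0

/-- If every `e i` is absorbed by `a i` on its left, then it may be inserted in front of
`a (i + 1)`: group the product `a 0 * e 0 * a 1 * e 1 * ⋯` in two different ways. -/
theorem infProd_insert_of_mul_eq_left (a e : ℕ → S) (h : ∀ i, a i * e i = a i) :
    (OmegaSemigroup.infProd (fun n => Nat.casesOn n (a 0) fun i => e i * a (i + 1) : ℕ → S) : T) =
      OmegaSemigroup.infProd a := by
  set s : ℕ → S := fun n => if n % 2 = 0 then a (n / 2) else e (n / 2) with hs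
  have s0 : ∀ i, s (2 * i) = a i := fun i => by simp [hs]
  have s1 : ∀ i, s (2 * i + 1) = e i := fun i => by
    simp only [hs]
    rw [if_neg (by omega), show (2 * i + 1) / 2 = i by omega]
  have hpair : ∀ i, blockBetween s (2 * i) (2 * (i + 1)) = a i := fun i => by
    rw [show 2 * (i + 1) = 2 * i + 1 + 1 by ring, blockBetween_succ s (by omega),
      blockBetween_self_succ, s0, s1, h]
  have h1 := infProd_blockBetween (T := T) s (k := fun i => 2 * i)
    (strictMono_nat_of_lt_succ fun i => by omega) rfl
  have h2 := infProd_blockBetween (T := T) s (k := fun i => 2 * i - 1)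
    (strictMono_nat_of_lt_succ fun i => by omega) rfl
  simp only [hpair] at h1
  rw [h1, ← h2]
  congr 1
  funext n
  cases n with
  | zero => exact ((blockBetween_self_succ s 0).trans (s0 0)).symm
  | succ n =>
    have e1 : 2 * (n + 1) - 1 = 2 * n + 1 := by omega
    have e2 : 2 * (n + 1 + 1) - 1 = 2 * n + 1 + 1 + 1 := by omega
    simp only [e1, e2]
    rw [blockBetween_succ s (by omega), blockBetween_self_succ, s1,
      show 2 * n + 1 + 1 = 2 * (n + 1) by ring, s0]

/-- Inserting `e j` into the infinite product of `f` at the positions `p j` does not change its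
value, provided that `e j` is absorbed by `e i` followed by the factors from `p i` to `p j`, for all
`i < j`, and by these factors alone if `j = i + N`. The first condition removes all insertions but
those at the start of each group of `N` blocks, and `infProd_insert_of_mul_eq_left` the others. -/
theorem infProd_insert_at {f : ℕ → S} {p : ℕ → ℕ} (hp : StrictMono p) (hp0 : 0 < p 0) {e : ℕ → S}
    (he0 : blockBetween f 0 (p 0) * e 0 = blockBetween f 0 (p 0))
    (he : ∀ i j, i < j →
      e i * blockBetween f (p i) (p j) * e j = e i * blockBetween f (p i) (p j))
    {N : ℕ} (hN : 0 < N)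
    (hfar : ∀ i, blockBetween f (p i) (p (i + N)) * e (i + N) = blockBetween f (p i) (p (i + N)))
    {y : ℕ → S} (hy0 : y 0 = blockBetween f 0 (p 0) * e 0)
    (hy : ∀ j, y (j + 1) = e j * blockBetween f (p j) (p (j + 1)) * e (j + 1)) :
    (OmegaSemigroup.infProd y : T) = OmegaSemigroup.infProd f := by
  have hblock : ∀ j m, blockBetween y (j + 1) (j + 1 + m + 1) =
      e j * blockBetween f (p j) (p (j + m + 1)) := by
    intro j m
    induction m with
    | zero => rw [add_zero, blockBetween_self_succ, hy, he j (j + 1) (by omega)]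
    | succ m ih =>
      have h1 : p j < p (j + m + 1) := hp (by omega)
      have h2 : p (j + m + 1) < p (j + m + 1 + 1) := hp (by omega)
      calc blockBetween y (j + 1) (j + 1 + (m + 1) + 1)
          = e j * blockBetween f (p j) (p (j + m + 1)) * y (j + m + 1 + 1) := by
            rw [blockBetween_succ y (by omega), ← add_assoc, ih,
              show j + 1 + m + 1 = j + m + 1 + 1 by ring]
        _ = e j * blockBetween f (p j) (p (j + m + 1)) * e (j + m + 1) *
              blockBetween f (p (j + m + 1)) (p (j + m + 1 + 1)) * e (j + m + 1 + 1) := by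
            rw [hy]; simp only [mul_assoc]
        _ = e j * blockBetween f (p j) (p (j + m + 1 + 1)) * e (j + m + 1 + 1) := by
            rw [he j _ (by omega), mul_assoc (e j), blockBetween_mul f h1 h2]
        _ = e j * blockBetween f (p j) (p (j + (m + 1) + 1)) := he j _ (by omega)
  set k : ℕ → ℕ := fun n => Nat.casesOn n 0 fun i => N * i + 1 with hk
  set q : ℕ → ℕ := fun n => Nat.casesOn n 0 fun i => p (N * i) with hq
  have hkm : StrictMono k := strictMono_nat_of_lt_succ fun n => by
    cases n with
    | zero => simp [hk]
    | succ n => simp only [hk]; nlinarith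
  have hqm : StrictMono q := strictMono_nat_of_lt_succ fun n => by
    cases n with
    | zero => simpa [hq] using hp0
    | succ n => simp only [hq]; exact hp (by nlinarith)
  have habs : ∀ n, blockBetween f (q n) (q (n + 1)) * e (N * n) =
      blockBetween f (q n) (q (n + 1)) := by
    intro n
    cases n with
    | zero => simpa [hq] using he0
    | succ n =>
      have h1 := hfar (N * n)
      rw [show N * n + N = N * (n + 1) by ring] at h1
      exact h1
  rw [← infProd_blockBetween f hqm rfl, ← infProd_blockBetween y hkm rfl,
    ← infProd_insert_of_mul_eq_left (fun i => blockBetween f (q i) (q (i + 1)))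
      (fun i => e (N * i)) habs]
  congr 1
  funext n
  cases n with
  | zero => exact (blockBetween_self_succ y 0).trans (hy0.trans he0)
  | succ n =>
    have h1 := hblock (N * n) (N - 1)
    rw [show N * n + 1 + (N - 1) + 1 = N * (n + 1) + 1 by rw [mul_add]; omega,
      show N * n + (N - 1) + 1 = N * (n + 1) by rw [mul_add]; omega] at h1
    exact h1

end InfiniteProducts

/-! ### Minimal idempotent factors -/

section Cuts

variable {A S : Type u} {T : Type v} [Semigroup S] [OmegaSemigroup S T]
  (α : OmegaHom (FreeSemigroup A) (ℕ → A) S T)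

/-- The value of a finite word, in the monoid `S¹` obtained by adjoining a unit to `S` so that the
empty word has a value. -/
def wordVal (l : List A) : WithOne S :=
  (l.map fun a => (α.fin (FreeSemigroup.of a) : WithOne S)).prod

@[simp]
theorem wordVal_append (l l' : List A) : wordVal α (l ++ l') = wordVal α l * wordVal α l' := by
  simp [wordVal]

theorem wordVal_toWord (x : FreeSemigroup A) : wordVal α (toWord x) = (α.fin x : WithOne S) := by
  induction x using FreeSemigroup.recOnMul with
  | ih1 a => simp [wordVal, toWord, FreeSemigroup.of]
  | ih2 a y _ ih =>
    rw [toWord_mul, wordVal_append, ih, map_mul, WithOne.coe_mul]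
    congr 1

theorem exists_toWord_eq {l : List A} (hl : l ≠ []) : ∃ x : FreeSemigroup A, toWord x = l := by
  cases l with
  | nil => exact absurd rfl hl
  | cons a l => exact ⟨⟨a, l⟩, rfl⟩

theorem exists_imageS_eq_wordVal {l : List A} (hl : l ≠ []) :
    ∃ s : imageS α, ((s : S) : WithOne S) = wordVal α l := by
  obtain ⟨x, rfl⟩ := exists_toWord_eq hl
  exact ⟨⟨α.fin x, x, rfl⟩, (wordVal_toWord α x).symm⟩

/-- A nonempty word whose value is idempotent. -/
def IdemWord (v : List A) : Prop := v ≠ [] ∧ IsIdempotentElem (wordVal α v)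

/-- A nonempty word whose value is idempotent, and none of whose proper nonempty factors has an
idempotent value. -/
def MinIdemWord (v : List A) : Prop :=
  IdemWord α v ∧ ∀ u, u <:+: v → IdemWord α u → u = v

/-- The word `z` ends with a minimal idempotent word. The cuts of an infinite word are the
positions where such a prefix ends. -/
def EndsAtCut (z : List A) : Prop := ∃ v, v <:+ z ∧ MinIdemWord α v

variable {α}

theorem IdemWord.exists_minIdemWord {l : List A} (hl : IdemWord α l) :
    ∃ v, v <:+: l ∧ MinIdemWord α v := by
  induction hn : l.length using Nat.strong_induction_on generalizing l with
  | _ n ih =>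
  by_cases h : ∀ u, u <:+: l → IdemWord α u → u = l
  · exact ⟨l, List.infix_rfl, hl, h⟩
  · push Not at h
    obtain ⟨u, hu, hu', hne⟩ := h
    have hlt : u.length < n :=
      hn ▸ lt_of_le_of_ne hu.length_le fun heq => hne (hu.eq_of_length heq)
    obtain ⟨v, hv, hv'⟩ := ih _ hlt hu' rfl
    exact ⟨v, hv.trans hu, hv'⟩

theorem MinIdemWord.eq_of_suffix {u v z : List A} (hu : MinIdemWord α u) (hv : MinIdemWord α v)
    (huz : u <:+ z) (hvz : v <:+ z) : u = v := by
  rcases List.suffix_or_suffix_of_suffix huz hvz with h | h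
  · exact hv.2 u h.isInfix hu.1
  · exact (hu.2 v h.isInfix hv.1).symm

theorem EndsAtCut.ne_nil {z : List A} (hz : EndsAtCut α z) : z ≠ [] := by
  rintro rfl
  obtain ⟨v, hv, hv'⟩ := hz
  exact hv'.1.1 (List.suffix_nil.1 hv)

/-- If a minimal idempotent word ends before another one does, then it also starts before. -/
theorem MinIdemWord.suffix_append {x r v v' : List A} (hr : r ≠ []) (hv : MinIdemWord α v)
    (hvx : v <:+ x) (hv' : MinIdemWord α v') (hvx' : v' <:+ x ++ r) : v' <:+ v ++ r := by
  have h : v ++ r <:+ x ++ r := by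
    obtain ⟨t, rfl⟩ := hvx
    exact ⟨t, by simp⟩
  rcases List.suffix_or_suffix_of_suffix hvx' h with h' | h'
  · exact h'
  · have hin : v <:+: v' := (List.prefix_append v r).isInfix.trans h'.isInfix
    have heq := hv'.2 v hin hv.1
    have h1 := h'.length_le
    have h2 := List.length_pos_iff.2 hr
    rw [List.length_append, ← heq] at h1
    omega

theorem wordVal_mul_of_suffix {v l : List A} (hv : MinIdemWord α v) (h : v <:+ l) :
    wordVal α l * wordVal α v = wordVal α l := by
  obtain ⟨t, rfl⟩ := h
  rw [wordVal_append, mul_assoc, hv.1.2.eq]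

variable (α) in
/-- Every word of length at least `N` has a nonempty factor with an idempotent value. -/
def IdemBound (N : ℕ) : Prop := ∀ l : List A, N ≤ l.length → ∃ u, u <:+: l ∧ IdemWord α u

theorem MinIdemWord.length_le {N : ℕ} (hN : IdemBound α N) {v : List A} (hv : MinIdemWord α v) :
    v.length ≤ N := by
  by_contra! h
  obtain ⟨u, hu, hu'⟩ := hN (v.take N) (by rw [List.length_take]; omega)
  have h1 := hv.2 u (hu.trans (List.take_prefix _ _).isInfix) hu'
  have h2 := hu.length_le
  rw [h1, List.length_take] at h2
  omega

/-- A cut is found after any word `x` by reading `N` further letters. -/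
theorem IdemBound.exists_endsAtCut {N : ℕ} (hN : IdemBound α N) (x : List A) {l : List A}
    (hl : N ≤ l.length) : ∃ r, r <+: l ∧ r ≠ [] ∧ EndsAtCut α (x ++ r) := by
  obtain ⟨u, hu, hu'⟩ := hN l hl
  obtain ⟨v, hv, hv'⟩ := hu'.exists_minIdemWord
  obtain ⟨s, t, rfl⟩ := hv.trans hu
  exact ⟨s ++ v, List.prefix_append _ _, by simp [hv'.1.1], v, ⟨x ++ s, by simp⟩, hv'⟩

theorem idemBound_two_pow [Finite S] (α : OmegaHom (FreeSemigroup A) (ℕ → A) S T) :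
    IdemBound α (2 ^ (3 * Nat.card S)) := by
  intro l hl
  rcases isEmpty_or_nonempty S with hS | hS
  · have : l ≠ [] := List.ne_nil_of_length_pos (lt_of_lt_of_le (by positivity) hl)
    obtain ⟨x, -⟩ := exists_toWord_eq this
    exact (hS.false (α.fin x)).elim
  · have hcard : Nat.card (WithOne S) = Nat.card S + 1 := Finite.card_option
    have hpos : 0 < Nat.card S := Nat.card_pos
    have : Finite (WithOne S) := inferInstanceAs (Finite (Option S))
    obtain ⟨u, h1, h2, h3⟩ := exists_idempotent_infix
      (fun a => (α.fin (FreeSemigroup.of a) : WithOne S)) (l := l)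
      (le_trans (Nat.pow_le_pow_right (by norm_num) (by omega)) hl)
    exact ⟨u, h1, h2, h3⟩

/-! ### Emitting the letters of a well-formed word at the cuts -/

variable (α) in
/-- The letter of the well-formed word that is emitted when the prefix `z` has been read: `z` ends
at a cut, and the letter consists of the idempotent of the previous cut (if there is one), the value
of the word read since the previous cut, and the idempotent of the present cut. -/
def Emits (z : List A) : WfAlphabet α → Prop
  | (none, s, f) =>
    (∃ v, v <:+ z ∧ MinIdemWord α v ∧ ((f.1 : S) : WithOne S) = wordVal α v) ∧
      ((s : S) : WithOne S) = wordVal α z ∧ ∀ y, y <+: z → y ≠ z → ¬ EndsAtCut α y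
  | (some e, s, f) => ∃ x r v v', z = x ++ r ∧ r ≠ [] ∧
      (v <:+ x ∧ MinIdemWord α v ∧ ((e.1 : S) : WithOne S) = wordVal α v) ∧
      (v' <:+ z ∧ MinIdemWord α v' ∧ ((f.1 : S) : WithOne S) = wordVal α v') ∧
      ((s : S) : WithOne S) = wordVal α r ∧
      ∀ r', r' <+: r → r' ≠ [] → r' ≠ r → ¬ EndsAtCut α (x ++ r')

theorem Emits.endsAtCut {z : List A} {b : WfAlphabet α} (h : Emits α z b) : EndsAtCut α z := by
  rcases b with ⟨_ | e, s, f⟩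
  · obtain ⟨⟨v, h1, h2, -⟩, -⟩ := h
    exact ⟨v, h1, h2⟩
  · obtain ⟨-, -, -, v, -, -, -, ⟨h1, h2, -⟩, -⟩ := h
    exact ⟨v, h1, h2⟩

theorem idemS_ext {e f : idemS α} (h : ((e.1 : S) : WithOne S) = ((f.1 : S) : WithOne S)) :
    e = f :=
  Subtype.ext (Subtype.ext (WithOne.coe_inj.1 h))

theorem imageS_ext {s t : imageS α} (h : ((s : S) : WithOne S) = ((t : S) : WithOne S)) : s = t :=
  Subtype.ext (WithOne.coe_inj.1 h)

/-- Two factorizations of a word at its last proper prefix that ends at a cut agree. -/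
theorem prefix_eq_of_last_cut {z x r x' r' : List A} (hz : z = x ++ r) (hz' : z = x' ++ r')
    (hr' : r' ≠ []) (hcut : EndsAtCut α x')
    (hlast : ∀ t, t <+: r → t ≠ [] → t ≠ r → ¬ EndsAtCut α (x ++ t)) (hle : x.length ≤ x'.length) :
    x = x' := by
  obtain ⟨t, rfl⟩ : x <+: x' :=
    List.prefix_of_prefix_length_le (hz ▸ List.prefix_append x r) (hz' ▸ List.prefix_append x' r') hle
  have hr : r = t ++ r' := by
    have := hz.symm.trans hz'
    rw [List.append_assoc] at this
    exact List.append_cancel_left this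
  by_contra hne
  refine hlast t ⟨r', hr.symm⟩ (by rintro rfl; simp at hne) (fun h => hr' ?_) hcut
  rw [hr] at h
  exact List.self_eq_append_right.1 h

theorem Emits.unique {z : List A} {b b' : WfAlphabet α} (h : Emits α z b) (h' : Emits α z b') :
    b = b' := by
  have aux : ∀ {e : idemS α} {s f : _} {s' f' : _}, Emits α z (none, s, f) →
      ¬ Emits α z (some e, s', f') := by
    rintro e s f s' f' ⟨-, -, h1⟩ ⟨x, r, v, v', hz, hr, ⟨h2, h3, -⟩, -⟩
    exact h1 x (hz ▸ List.prefix_append x r) (by rw [hz]; simpa using hr) ⟨v, h2, h3⟩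
  rcases b with ⟨_ | e, s, f⟩ <;> rcases b' with ⟨_ | e', s', f'⟩
  · obtain ⟨⟨v, h1, h2, h3⟩, h4, -⟩ := h
    obtain ⟨⟨v', h1', h2', h3'⟩, h4', -⟩ := h'
    obtain rfl := h2.eq_of_suffix h2' h1 h1'
    rw [imageS_ext (h4.trans h4'.symm), idemS_ext (h3.trans h3'.symm)]
  · exact (aux h h').elim
  · exact (aux h' h).elim
  · obtain ⟨x, r, v, w, hz, hr, ⟨h1, h2, h3⟩, ⟨h4, h5, h6⟩, h7, h8⟩ := h
    obtain ⟨x', r', v', w', hz', hr', ⟨h1', h2', h3'⟩, ⟨h4', h5', h6'⟩, h7', h8'⟩ := h'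
    have hx : x = x' := by
      rcases le_total x.length x'.length with hle | hle
      · exact prefix_eq_of_last_cut hz hz' hr' ⟨v', h1', h2'⟩ h8 hle
      · exact (prefix_eq_of_last_cut hz' hz hr ⟨v, h1, h2⟩ h8' hle).symm
    subst hx
    obtain rfl : r = r' := List.append_cancel_left (hz.symm.trans hz')
    obtain rfl := h2.eq_of_suffix h2' h1 h1'
    obtain rfl := h5.eq_of_suffix h5' h4 h4'
    rw [imageS_ext (h7.trans h7'.symm), idemS_ext (h3.trans h3'.symm),
      idemS_ext (h6.trans h6'.symm)]

/-! ### Words with the same short suffixes -/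

/-- The words `x` and `y` have the same suffixes of length at most `k`. -/
def SameSuffixes (k : ℕ) (x y : List A) : Prop := ∀ u : List A, u.length ≤ k → (u <:+ x ↔ u <:+ y)

theorem SameSuffixes.symm {k : ℕ} {x y : List A} (h : SameSuffixes k x y) : SameSuffixes k y x :=
  fun u hu => (h u hu).symm

theorem sameSuffixes_append_left {k : ℕ} (x : List A) {v : List A} (hv : k ≤ v.length) :
    SameSuffixes k (x ++ v) v := fun _ hu =>
  ⟨fun h => List.suffix_of_suffix_length_le h (List.suffix_append x v) (hu.trans hv),
    fun h => h.trans (List.suffix_append x v)⟩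

theorem SameSuffixes.eq_of_length_lt {k : ℕ} {x y : List A} (h : SameSuffixes k x y)
    (hx : x.length < k) : x = y := by
  have h1 : x <:+ y := (h x hx.le).1 List.suffix_rfl
  have h2 : y.length ≤ x.length := by
    by_contra! hlt
    -- the suffix of `y` that is one letter longer than `x` would be a suffix of `x`
    have h3 := (h (y.drop (y.length - (x.length + 1)))
      (by rw [List.length_drop]; omega)).2 (List.drop_suffix _ _)
    have h4 := h3.length_le
    rw [List.length_drop] at h4
    omega
  exact h1.eq_of_length (le_antisymm h1.length_le h2)

/-- The emitted letter depends only on the suffixes of length at most `2 * N`. -/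
theorem Emits.of_sameSuffixes {N : ℕ} (hN : IdemBound α N) (hN0 : 0 < N) {y z : List A}
    (hzy : SameSuffixes (2 * N) z y) {b : WfAlphabet α} (h : Emits α z b) : Emits α y b := by
  rcases b with ⟨_ | e, s, f⟩
  · have hz : z.length ≤ N := by
      by_contra! hlt
      obtain ⟨r, h1, -, h2⟩ := hN.exists_endsAtCut [] (l := z.take N) (by rw [List.length_take]; omega)
      refine h.2.2 r (h1.trans (List.take_prefix _ _)) (fun heq => ?_) h2
      have h3 := h1.length_le
      rw [heq, List.length_take] at h3
      omega
    rwa [← hzy.eq_of_length_lt (by omega)]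
  · obtain ⟨x, r, v, v', hz, hr, ⟨h1, h2, h3⟩, ⟨h4, h5, h6⟩, h7, h8⟩ := h
    have hrN : r.length ≤ N := by
      by_contra! hlt
      obtain ⟨t, ht, ht0, ht'⟩ :=
        hN.exists_endsAtCut x (l := r.take N) (by rw [List.length_take]; omega)
      refine h8 t (ht.trans (List.take_prefix _ _)) ht0 (fun heq => ?_) ht'
      have h9 := ht.length_le
      rw [heq, List.length_take] at h9
      omega
    have hvN := h2.length_le hN
    have hvN' := h5.length_le hN
    have hvr : v ++ r <:+ y := by
      refine (hzy _ (by rw [List.length_append]; omega)).1 ?_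
      obtain ⟨t, rfl⟩ := h1
      exact ⟨t, by rw [hz]; simp⟩
    obtain ⟨t, rfl⟩ := hvr
    refine ⟨t ++ v, r, v, v', by simp, hr, ⟨List.suffix_append _ _, h2, h3⟩,
      ⟨(hzy _ (by omega)).1 h4, h5, h6⟩, h7, fun r' hr' hr0 hne hcut => ?_⟩
    obtain ⟨u, hu, hu'⟩ := hcut
    -- a minimal idempotent word that ends strictly after `v` cannot contain `v`
    have hu1 : u <:+ v ++ r' := h2.suffix_append hr0 (List.suffix_append t v) hu' hu
    refine h8 r' hr' hr0 hne ⟨u, hu1.trans ?_, hu'⟩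
    obtain ⟨q, rfl⟩ := h1
    exact ⟨q, by simp⟩

end Cuts

/-! ### The well-formed word of an infinite word -/

section WfWord

variable {A S : Type u} {T : Type v} [Semigroup S] [OmegaSemigroup S T]
  {α : OmegaHom (FreeSemigroup A) (ℕ → A) S T}

/-- The factor of the infinite word `w` from position `i` to position `j - 1`. -/
def segment (w : ℕ → A) (i j : ℕ) : List A := (List.range' i (j - i)).map w

theorem length_segment (w : ℕ → A) (i j : ℕ) : (segment w i j).length = j - i := by
  simp [segment]

theorem segment_ne_nil (w : ℕ → A) {i j : ℕ} (h : i < j) : segment w i j ≠ [] :=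
  List.ne_nil_of_length_pos (by rw [length_segment]; omega)

theorem wordPrefix_append_segment (w : ℕ → A) {i j : ℕ} (h : i ≤ j) :
    wordPrefix w i ++ segment w i j = wordPrefix w j := by
  obtain ⟨m, rfl⟩ := Nat.exists_eq_add_of_le h
  simp only [wordPrefix, segment, List.range_eq_range', ← List.map_append]
  rw [Nat.add_sub_cancel_left]
  have := List.range'_append_1 (s := 0) (m := i) (n := m)
  rw [zero_add] at this
  rw [this]

theorem wordPrefix_succ (w : ℕ → A) (n : ℕ) : wordPrefix w (n + 1) = wordPrefix w n ++ [w n] := by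
  simp [wordPrefix, List.range_succ]

theorem wordPrefix_prefix (w : ℕ → A) {i j : ℕ} (h : i ≤ j) : wordPrefix w i <+: wordPrefix w j :=
  ⟨_, wordPrefix_append_segment w h⟩

theorem eq_wordPrefix_of_prefix {w : ℕ → A} {n : ℕ} {y : List A} (h : y <+: wordPrefix w n) :
    y = wordPrefix w y.length := by
  have hle : y.length ≤ n := by simpa [wordPrefix_length] using h.length_le
  exact (List.prefix_of_prefix_length_le h (wordPrefix_prefix w hle)
    (by rw [wordPrefix_length])).eq_of_length (by rw [wordPrefix_length])

theorem omegaConcat_of (w : ℕ → A) : omegaConcat (fun n => FreeSemigroup.of (w n)) = w := by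
  refine (omegaConcat_spec _).unique ⟨fun N => ⟨N, le_rfl, by simp [toWord]⟩, fun n => ?_⟩
  have : concatFirst (fun i => toWord (FreeSemigroup.of (w i))) n = wordPrefix w n := by
    induction n with
    | zero => rfl
    | succ n ih => rw [concatFirst_succ, wordPrefix_succ, ih]; rfl
  rw [this, wordPrefix_length]

theorem inf_eq_infProd (α : OmegaHom (FreeSemigroup A) (ℕ → A) S T) (w : ℕ → A) :
    α.inf w = OmegaSemigroup.infProd (fun n => α.fin (FreeSemigroup.of (w n))) := by
  rw [← α.map_infProd (fun n => FreeSemigroup.of (w n))]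
  exact congrArg α.inf (omegaConcat_of w).symm

theorem coe_blockBetween (α : OmegaHom (FreeSemigroup A) (ℕ → A) S T) (w : ℕ → A) {i j : ℕ}
    (h : i < j) :
    ((blockBetween (fun n => α.fin (FreeSemigroup.of (w n))) i j : S) : WithOne S) =
      wordVal α (segment w i j) := by
  induction j, h using Nat.le_induction with
  | base => rw [blockBetween_self_succ]; simp [segment, wordVal]
  | succ j hj ih =>
    have : segment w i (j + 1) = segment w i j ++ [w j] := by
      simp only [segment]
      have hj' : i < j := hj
      rw [show j + 1 - i = j - i + 1 by omega, List.range'_1_concat, List.map_append]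
      simp only [List.map_cons, List.map_nil]
      rw [show i + (j - i) = j by omega]
    rw [blockBetween_succ _ hj, WithOne.coe_mul, ih, this, wordVal_append]
    simp [wordVal]

theorem infinite_cuts {N : ℕ} (hN : IdemBound α N) (w : ℕ → A) :
    {n | EndsAtCut α (wordPrefix w n)}.Infinite := by
  refine Set.infinite_of_not_bddAbove fun ⟨b, hb⟩ => ?_
  obtain ⟨r, hr, hr0, hcut⟩ := hN.exists_endsAtCut (wordPrefix w b) (l := segment w b (b + N))
    (by rw [length_segment]; omega)
  have hpre : wordPrefix w b ++ r <+: wordPrefix w (b + N) := by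
    rw [← wordPrefix_append_segment w (Nat.le_add_right b N)]
    exact (List.prefix_append_right_inj _).2 hr
  rw [eq_wordPrefix_of_prefix hpre] at hcut
  have h1 := hb hcut
  rw [List.length_append, wordPrefix_length] at h1
  have h2 := List.length_pos_iff.2 hr0
  omega

variable (α) in
open Classical in
/-- The word emitted when the prefix `z` has been read: one letter if `z` ends at a cut, and the
empty word otherwise. -/
noncomputable def emission (z : List A) : List (WfAlphabet α) :=
  if h : ∃ b, Emits α z b then [h.choose] else []

theorem Emits.emission_eq {z : List A} {b : WfAlphabet α} (h : Emits α z b) :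
    emission α z = [b] := by
  have h' : ∃ b, Emits α z b := ⟨b, h⟩
  rw [emission, dif_pos h', h'.choose_spec.unique h]

theorem emission_eq_nil {z : List A} (h : ¬ EndsAtCut α z) : emission α z = [] :=
  dif_neg fun ⟨_, hb⟩ => h hb.endsAtCut

theorem emission_eq_of_sameSuffixes {N : ℕ} (hN : IdemBound α N) (hN0 : 0 < N) {y z : List A}
    (h : SameSuffixes (2 * N) z y) : emission α z = emission α y := by
  have : Emits α z = Emits α y := funext fun b => propext
    ⟨fun hb => hb.of_sameSuffixes hN hN0 h, fun hb => hb.of_sameSuffixes hN hN0 h.symm⟩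
  rw [emission, emission, this]

open Classical in
/-- The words emitted along the prefixes of an infinite word `w` concatenate to a well-formed word
with the same value as `w`. -/
theorem exists_wellFormed_emission {N : ℕ} (hN : IdemBound α N) (hN0 : 0 < N) (w : ℕ → A) :
    ∃ b : ℕ → WfAlphabet α, IsWellFormed α b ∧ evalOmega α b = α.inf w ∧
      IsInfiniteConcat (fun n => emission α (wordPrefix w n)) b := by
  set Z : ℕ → Prop := fun n => EndsAtCut α (wordPrefix w n) with hZ
  have hinf : {n | Z n}.Infinite := infinite_cuts hN w
  set p : ℕ → ℕ := Nat.nth Z with hp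
  have hpm : StrictMono p := Nat.nth_strictMono hinf
  have hpZ : ∀ j, EndsAtCut α (wordPrefix w (p j)) := fun j => Nat.nth_mem_of_infinite hinf j
  have hp0 : 0 < p 0 := Nat.pos_of_ne_zero fun h => (hpZ 0).ne_nil (by rw [h]; rfl)
  have hgap : ∀ j m, p j < m → m < p (j + 1) → ¬ Z m := fun j m h1 h2 hm => by
    have h3 := Nat.nth_count hm
    have h4 : j < Nat.count Z m := hpm.lt_iff_lt.1 (by rw [hp, h3]; exact h1)
    have h5 : Nat.count Z m < j + 1 := hpm.lt_iff_lt.1 (by rw [hp, h3]; exact h2)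
    omega
  have hfirst : ∀ m, m < p 0 → ¬ Z m := fun m h1 hm => by
    have h3 := Nat.nth_count hm
    have h4 : Nat.count Z m < 0 := hpm.lt_iff_lt.1 (by rw [hp, h3]; exact h1)
    omega
  choose v hv hvm using hpZ
  -- the idempotents of the cuts and the values of the words between them
  have hs : ∀ j, ∃ e : idemS α, ((e.1 : S) : WithOne S) = wordVal α (v j) := fun j => by
    obtain ⟨s, hs⟩ := exists_imageS_eq_wordVal α (hvm j).1.1
    refine ⟨⟨s, ?_⟩, hs⟩
    have h1 := (hvm j).1.2.eq
    rw [← hs, ← WithOne.coe_mul, WithOne.coe_inj] at h1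
    exact Subtype.ext h1
  choose e he using hs
  obtain ⟨s0, hs0⟩ := exists_imageS_eq_wordVal α (segment_ne_nil w hp0)
  choose s hs using fun j =>
    exists_imageS_eq_wordVal α (segment_ne_nil w (hpm (Nat.lt_succ_self j)))
  have hseg0 : segment w 0 (p 0) = wordPrefix w (p 0) :=
    wordPrefix_append_segment w (Nat.zero_le _)
  set f : ℕ → S := fun n => α.fin (FreeSemigroup.of (w n)) with hf
  set b : ℕ → WfAlphabet α := fun n =>
    Nat.casesOn n (none, s0, e 0) fun j => (some (e j), s j, e (j + 1)) with hb
  have hblock0 : (s0 : S) = blockBetween f 0 (p 0) :=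
    WithOne.coe_inj.1 (hs0.trans (coe_blockBetween α w hp0).symm)
  have hblock : ∀ j, (s j : S) = blockBetween f (p j) (p (j + 1)) := fun j =>
    WithOne.coe_inj.1 ((hs j).trans (coe_blockBetween α w (hpm (Nat.lt_succ_self j))).symm)
  have hsplit : ∀ i j, i < j → wordPrefix w (p j) = wordPrefix w (p i) ++ segment w (p i) (p j) :=
    fun i j hij => (wordPrefix_append_segment w (hpm hij).le).symm
  refine ⟨b, ⟨rfl, fun i => ?_⟩, ?_, ?_⟩
  · cases i <;> rfl
  · rw [inf_eq_infProd]
    refine infProd_insert_at (f := f) (p := p) hpm hp0 (e := fun j => ((e j).1 : S)) (N := N)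
      ?_ (fun i j hij => ?_) hN0 (fun i => ?_) ?_ (fun j => ?_)
    · rw [← WithOne.coe_inj, WithOne.coe_mul, coe_blockBetween α w hp0, he, hseg0]
      exact wordVal_mul_of_suffix (hvm 0) (hv 0)
    · rw [← WithOne.coe_inj]
      simp only [WithOne.coe_mul]
      rw [coe_blockBetween α w (hpm hij), he, he, ← wordVal_append]
      exact wordVal_mul_of_suffix (hvm j) ((hvm i).suffix_append
        (segment_ne_nil w (hpm hij)) (hv i) (hvm j) (hsplit i j hij ▸ hv j))
    · have hlt : i < i + N := by omega
      rw [← WithOne.coe_inj, WithOne.coe_mul, coe_blockBetween α w (hpm hlt), he]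
      refine wordVal_mul_of_suffix (hvm _) (List.suffix_of_suffix_length_le
        (hsplit i _ hlt ▸ hv (i + N)) (List.suffix_append _ _) ?_)
      have h1 := hpm.add_le_nat N i
      have h2 := (hvm (i + N)).length_le hN
      rw [length_segment]
      simp only [add_comm N i] at h1
      omega
    · change (s0 : S) * _ = _
      rw [hblock0]
    · change ((e j).1 : S) * (s j : S) * _ = _
      rw [hblock]
  · have hemit : ∀ j, Emits α (wordPrefix w (p j)) (b j) := by
      intro j
      cases j with
      | zero =>
        refine ⟨⟨v 0, hv 0, hvm 0, he 0⟩, hseg0 ▸ hs0, fun y hy hne hcut => ?_⟩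
        have h1 := eq_wordPrefix_of_prefix hy
        rw [h1] at hcut
        refine hfirst y.length ?_ hcut
        have h2 := hy.length_le
        rw [wordPrefix_length] at h2
        exact lt_of_le_of_ne h2 fun h3 => hne (by rw [h1, h3])
      | succ j =>
        refine ⟨wordPrefix w (p j), segment w (p j) (p (j + 1)), v j, v (j + 1),
          hsplit j _ (Nat.lt_succ_self j), segment_ne_nil w (hpm (Nat.lt_succ_self j)),
          ⟨hv j, hvm j, he j⟩, ⟨hv _, hvm _, he _⟩, hs j, fun r hr hr0 hne hcut => ?_⟩
        have h1 : wordPrefix w (p j) ++ r = wordPrefix w (p j + r.length) := by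
          have h2 : wordPrefix w (p j) ++ r <+: wordPrefix w (p (j + 1)) := by
            rw [hsplit j _ (Nat.lt_succ_self j)]
            exact (List.prefix_append_right_inj _).2 hr
          have h3 := eq_wordPrefix_of_prefix h2
          rwa [List.length_append, wordPrefix_length] at h3
        have h2 := List.length_pos_iff.2 hr0
        rw [h1] at hcut
        refine hgap j (p j + r.length) (by omega) ?_ hcut
        have h3 : r.length < (segment w (p j) (p (j + 1))).length :=
          lt_of_le_of_ne hr.length_le fun h => hne (hr.eq_of_length h)
        rw [length_segment] at h3
        omega
    have hcount : ∀ n, concatFirst (fun n => emission α (wordPrefix w n)) n =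
        wordPrefix b (Nat.count Z n) := by
      intro n
      induction n with
      | zero => simp [concatFirst, wordPrefix]
      | succ n ih =>
        rw [concatFirst_succ, ih, Nat.count_succ]
        split_ifs with hn
        · have h1 := hemit (Nat.count Z n)
          rw [hp, Nat.nth_count hn] at h1
          rw [h1.emission_eq, wordPrefix_succ]
        · rw [emission_eq_nil hn, List.append_nil, add_zero]
    refine ⟨fun n => ⟨p n, hpm.le_apply, ?_⟩, fun n => ?_⟩
    · change emission α (wordPrefix w (p n)) ≠ []
      rw [(hemit n).emission_eq]
      exact List.cons_ne_nil _ _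
    · rw [hcount, wordPrefix_length]

end WfWord

/-! ### Partitions into suffix languages -/

section Partitions

variable {A : Type u}

theorem mem_partOf {P : Set (Set (List A))} (hP : Setoid.IsPartition P) (x : List A) :
    x ∈ (partOf hP x).1 :=
  (hP.2 x).choose_spec.1.2

theorem partOf_eq_of_mem {P : Set (Set (List A))} (hP : Setoid.IsPartition P) {x : List A} (X : P)
    (h : x ∈ X.1) : partOf hP x = X :=
  Subtype.ext ((hP.2 x).unique ⟨(partOf hP x).2, mem_partOf hP x⟩ ⟨X.2, h⟩)

theorem SUk_subset_SU [Finite A] (k : ℕ) : SUk k A ⊆ SU A := fun _ hX =>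
  BooleanSubalgebra.closure_mono (by rintro _ ⟨w, -, rfl⟩; exact ⟨w, rfl⟩) hX

/-- A suffix language does not separate words that have the same suffixes of length at most `k`,
for `k` large enough. -/
theorem eventually_sameSuffixes_of_mem_SU [Finite A] {X : Set (List A)} (hX : X ∈ SU A) :
    ∀ᶠ k in Filter.atTop, ∀ x y, SameSuffixes k x y → (x ∈ X ↔ y ∈ X) := by
  refine BooleanSubalgebra.closure_bot_sup_induction
    (p := fun X _ => ∀ᶠ k in Filter.atTop, ∀ x y, SameSuffixes k x y → (x ∈ X ↔ y ∈ X))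
    ?_ ?_ ?_ ?_ hX
  · rintro _ ⟨w, rfl⟩
    filter_upwards [Filter.eventually_ge_atTop w.length] with k hk x y hxy
    exact hxy w hk
  · exact Filter.Eventually.of_forall fun k x y _ => Iff.rfl
  · intro X _ Y _ h1 h2
    filter_upwards [h1, h2] with k h1 h2 x y hxy
    exact or_congr (h1 x y hxy) (h2 x y hxy)
  · intro X _ h
    filter_upwards [h] with k h x y hxy
    exact not_congr (h x y hxy)

/-- The set of suffixes of length at most `k` of a word. -/
def shortSuffixes (k : ℕ) (x : List A) : Set {u : List A // u.length ≤ k} := {u | u.1 <:+ x}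

theorem shortSuffixes_eq_iff {k : ℕ} {x y : List A} :
    shortSuffixes k x = shortSuffixes k y ↔ SameSuffixes k x y :=
  ⟨fun h u hu => Set.ext_iff.1 h ⟨u, hu⟩, fun h => Set.ext fun u => h u.1 u.2⟩

theorem classes_ker_shortSuffixes_subset [Finite A] (k : ℕ) :
    (Setoid.ker (shortSuffixes (A := A) k)).classes ⊆ SUk k A := by
  rintro _ ⟨y, rfl⟩
  have : Finite {u : List A // u.length ≤ k} := (List.finite_length_le A k).to_subtype
  have heq : {x | Setoid.ker (shortSuffixes k) x y} =
      ⨅ u : {u : List A // u.length ≤ k}, {x | u.1 <:+ x ↔ u.1 <:+ y} := by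
    ext x
    simp only [Set.iInf_eq_iInter, Set.mem_iInter, Set.mem_ofPred_eq, Setoid.ker_def,
      shortSuffixes_eq_iff]
    exact ⟨fun h u => h u.1 u.2, fun h u hu => h ⟨u, hu⟩⟩
  change _ ∈ BooleanSubalgebra.closure _
  rw [heq]
  refine BooleanSubalgebra.iInf_mem fun u => ?_
  have hu : {x | u.1 <:+ x} ∈ BooleanSubalgebra.closure
      {X : Set (List A) | ∃ w : List A, w.length ≤ k ∧ X = {x | w <:+ x}} :=
    BooleanSubalgebra.subset_closure ⟨u.1, u.2, rfl⟩
  by_cases h : u.1 <:+ y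
  · simpa only [h, iff_true] using hu
  · simp only [h, iff_false]
    exact BooleanSubalgebra.compl_mem hu

end Partitions

/-! ### From well-formed words to the enrichment -/

section FromWellFormed

variable {A S : Type u} {T : Type v} [Finite A] [Semigroup S] [OmegaSemigroup S T] [Finite S]
  {α : OmegaHom (FreeSemigroup A) (ℕ → A) S T}

theorem emission_preimage_mem_enrich {C : OmegaClass.{u}} (hC : C.ClosedUnderInverseImage) {k : ℕ}
    (hk : ∀ x y, SameSuffixes k x y → emission α x = emission α y)
    {K : Set (ℕ → WfAlphabet α)} (hK : K ∈ C (WfAlphabet α)) :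
    {w | ∃ b ∈ K, IsInfiniteConcat (fun n => emission α (wordPrefix w n)) b} ∈
      enrich C (SUk k) A := by
  have hfin : Finite {u : List A // u.length ≤ k} := (List.finite_length_le A k).to_subtype
  set P : Set (Set (List A)) := (Setoid.ker (shortSuffixes k)).classes with hPdef
  have hP : Setoid.IsPartition P := Setoid.isPartition_classes _
  have hPfin : Finite P := (Setoid.finite_classes_ker (shortSuffixes k)).to_subtype
  choose rep hrep using fun X : P => Setoid.nonempty_of_mem_partition hP X.2
  have hemit : ∀ x, emission α (rep (partOf hP x)) = emission α x := fun x =>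
    hk _ _ (shortSuffixes_eq_iff.1 ((Setoid.rel_iff_exists_classes _).2
      ⟨_, (partOf hP x).2, hrep _, mem_partOf hP x⟩))
  let φ : FreeMonoid (P × A) →* FreeMonoid (WfAlphabet α) :=
    FreeMonoid.lift fun c => FreeMonoid.ofList (emission α (rep c.1))
  refine ⟨P, hP, hPfin, classes_ker_shortSuffixes_subset k, inverseImage φ K, hC _ _ φ K hK, ?_⟩
  have hφ : ∀ w : ℕ → A, (fun n => (φ (FreeMonoid.of (tagging hP w n))).toList) =
      fun n => emission α (wordPrefix w n) := fun w =>
    funext fun n => hemit (wordPrefix w n)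
  ext w
  simp only [inverseImage, Set.mem_preimage, Set.mem_ofPred_eq, hφ]

theorem coverable_enrich_of_coverable_wfLang {C : OmegaClass.{u}}
    (hC : C.ClosedUnderInverseImage) {N : ℕ} (hN : IdemBound α N) (hN0 : 0 < N)
    {L : Set (ℕ → A)} {Ls : Multiset (Set (ℕ → A))}
    (h : Coverable C (wfLang α L) (Ls.map (wfLang α))) :
    Coverable (enrich C (SUk (2 * N))) L Ls := by
  obtain ⟨K, hKfin, hKC, hcov, hsep⟩ := h
  let pull : Set (ℕ → WfAlphabet α) → Set (ℕ → A) := fun H =>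
    {w | ∃ b ∈ H, IsInfiniteConcat (fun n => emission α (wordPrefix w n)) b}
  refine ⟨pull '' K, hKfin.image _, ?_, fun w hw => ?_, ?_⟩
  · rintro _ ⟨H, hH, rfl⟩
    exact emission_preimage_mem_enrich hC
      (fun x y hxy => emission_eq_of_sameSuffixes hN hN0 hxy) (hKC hH)
  · obtain ⟨b, hwf, hval, hconc⟩ := exists_wellFormed_emission hN hN0 w
    obtain ⟨H, hH, hbH⟩ := hcov ⟨hwf, hval ▸ Set.mem_image_of_mem α.inf hw⟩
    exact ⟨pull H, ⟨H, hH, rfl⟩, b, hbH, hconc⟩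
  · rintro _ ⟨H, hH, rfl⟩
    obtain ⟨L'', hL'', hdisj⟩ := hsep H hH
    obtain ⟨L', hL', rfl⟩ := Multiset.mem_map.1 hL''
    refine ⟨L', hL', Set.eq_empty_of_forall_notMem ?_⟩
    rintro w ⟨⟨b, hbH, hconc⟩, hw⟩
    obtain ⟨b', hwf, hval, hconc'⟩ := exists_wellFormed_emission hN hN0 w
    obtain rfl := hconc.unique hconc'
    exact Set.eq_empty_iff_forall_notMem.1 hdisj b
      ⟨hbH, hwf, hval ▸ Set.mem_image_of_mem α.inf hw⟩

end FromWellFormed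

/-! ### From the enrichment to well-formed words -/

section ToWellFormed

variable {A : Type u}

/-- The tagging of the finite word `u`, read after the word `c`. -/
noncomputable def tagFrom {P : Set (Set (List A))} (hP : Setoid.IsPartition P) (c : List A) :
    List A → List (P × A)
  | [] => []
  | a :: u => (partOf hP c, a) :: tagFrom hP (c ++ [a]) u

theorem tagFrom_append {P : Set (Set (List A))} (hP : Setoid.IsPartition P) (c u u' : List A) :
    tagFrom hP c (u ++ u') = tagFrom hP c u ++ tagFrom hP (c ++ u) u' := by
  induction u generalizing c with
  | nil => simp [tagFrom]
  | cons a u ih => simp [tagFrom, ih]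

theorem length_tagFrom {P : Set (Set (List A))} (hP : Setoid.IsPartition P) (c u : List A) :
    (tagFrom hP c u).length = u.length := by
  induction u generalizing c with
  | nil => rfl
  | cons a u ih => simp [tagFrom, ih]

theorem tagFrom_wordPrefix {P : Set (Set (List A))} (hP : Setoid.IsPartition P) (w : ℕ → A)
    (n : ℕ) : tagFrom hP [] (wordPrefix w n) = wordPrefix (tagging hP w) n := by
  induction n with
  | zero => rfl
  | succ n ih =>
    rw [wordPrefix_succ, wordPrefix_succ, tagFrom_append, ih]
    rfl

theorem tagFrom_congr {P : Set (Set (List A))} (hP : Setoid.IsPartition P) {c c' : List A}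
    (h : ∀ u, partOf hP (c ++ u) = partOf hP (c' ++ u)) (u : List A) :
    tagFrom hP c u = tagFrom hP c' u := by
  induction u generalizing c c' with
  | nil => rfl
  | cons a u ih =>
    have h0 := h []
    simp only [List.append_nil] at h0
    simp only [tagFrom, h0]
    rw [ih (c := c ++ [a]) (c' := c' ++ [a]) fun u => by simpa using h (a :: u)]

theorem partOf_append_eq {k : ℕ} {P : Set (Set (List A))} (hP : Setoid.IsPartition P)
    (hk : ∀ X ∈ P, ∀ x y, SameSuffixes k x y → (x ∈ X ↔ y ∈ X)) (x : List A) {v : List A}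
    (hv : k ≤ v.length) (u : List A) : partOf hP (x ++ v ++ u) = partOf hP (v ++ u) := by
  refine partOf_eq_of_mem hP _ ?_
  rw [hk _ (partOf hP (v ++ u)).2 _ (v ++ u) ?_]
  · exact mem_partOf hP _
  · rw [List.append_assoc]
    exact sameSuffixes_append_left x (by rw [List.length_append]; omega)

variable {S : Type u} {T : Type v} [Semigroup S] [OmegaSemigroup S T]
  {α : OmegaHom (FreeSemigroup A) (ℕ → A) S T}

/-- An idempotent of `α(A⁺)` is the value of arbitrarily long words. -/
theorem exists_long_word (e : idemS α) (k : ℕ) :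
    ∃ x : FreeSemigroup A, α.fin x = (e.1 : S) ∧ k ≤ (toWord x).length := by
  obtain ⟨⟨s, y, rfl⟩, he⟩ := e
  have he' : α.fin y * α.fin y = α.fin y := congrArg Subtype.val he
  induction k with
  | zero => exact ⟨y, rfl, Nat.zero_le _⟩
  | succ k ih =>
    obtain ⟨x, hx, hlen⟩ := ih
    refine ⟨x * y, ?_, ?_⟩
    · rw [map_mul, hx]
      exact he'
    · rw [toWord_mul, List.length_append]
      exact Nat.add_le_add hlen (Nat.succ_le_succ (Nat.zero_le _))

/-- A word with the value of a given letter of the alphabet of well-formed words, made of a word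
`W s` of value `s` and of words `E e`, `E f` of values `e`, `f`. -/
def letterWord (W : imageS α → FreeSemigroup A) (E : idemS α → FreeSemigroup A) :
    WfAlphabet α → FreeSemigroup A
  | (some e, s, f) => E e * W s * E f
  | (none, s, f) => W s * E f

theorem fin_letterWord {W : imageS α → FreeSemigroup A} {E : idemS α → FreeSemigroup A}
    (hW : ∀ s, α.fin (W s) = (s : S)) (hE : ∀ e, α.fin (E e) = (e.1 : S)) (b : WfAlphabet α) :
    α.fin (letterWord W E b) = evalLetter α b := by
  rcases b with ⟨_ | e, s, f⟩ <;> simp [letterWord, evalLetter, hW, hE]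

theorem toWord_letterWord (W : imageS α → FreeSemigroup A) (E : idemS α → FreeSemigroup A)
    (b : WfAlphabet α) : ∃ t, toWord (letterWord W E b) = t ++ toWord (E b.2.2) := by
  rcases b with ⟨_ | e, s, f⟩
  · exact ⟨_, toWord_mul _ _⟩
  · exact ⟨_, toWord_mul _ _⟩

/-- The tagging of the word of a letter, on the assumption that the word of its left idempotent has
just been read. -/
noncomputable def tagLetter {P : Set (Set (List A))} (hP : Setoid.IsPartition P)
    (W : imageS α → FreeSemigroup A) (E : idemS α → FreeSemigroup A) (b : WfAlphabet α) :
    List (P × A) :=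
  tagFrom hP (b.1.elim [] fun e => toWord (E e)) (toWord (letterWord W E b))

/-- On a well-formed word, the assumption made by `tagLetter` holds at every letter, since tags
only depend on suffixes of length at most `k`. -/
theorem isInfiniteConcat_tagLetter {k : ℕ} {P : Set (Set (List A))} (hP : Setoid.IsPartition P)
    (hk : ∀ X ∈ P, ∀ x y, SameSuffixes k x y → (x ∈ X ↔ y ∈ X))
    (W : imageS α → FreeSemigroup A) {E : idemS α → FreeSemigroup A}
    (hE : ∀ e, k ≤ (toWord (E e)).length) {b : ℕ → WfAlphabet α} (hb : IsWellFormed α b) :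
    IsInfiniteConcat (fun n => tagLetter hP W E (b n))
      (tagging hP (omegaConcat fun n => letterWord W E (b n))) := by
  have key : ∀ n, concatFirst (fun n => tagLetter hP W E (b n)) n =
      tagFrom hP [] (concatFirst (fun n => toWord (letterWord W E (b n))) n) := by
    intro n
    induction n with
    | zero => rfl
    | succ n ih =>
      rw [concatFirst_succ, concatFirst_succ, ih, tagFrom_append]
      congr 1
      cases n with
      | zero => simp [tagLetter, hb.1, concatFirst]
      | succ n =>
        obtain ⟨t, ht⟩ := toWord_letterWord W E (b n)
        rw [concatFirst_succ, ht, List.nil_append, ← List.append_assoc]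
        simp only [tagLetter, hb.2 n, Option.elim_some]
        exact (tagFrom_congr hP (partOf_append_eq hP hk _ (hE _)) _).symm
  refine ⟨fun n => ⟨n, le_rfl, List.ne_nil_of_length_pos ?_⟩, fun n => ?_⟩
  · refine lt_of_lt_of_eq ?_ (length_tagFrom hP _ (toWord (letterWord W E (b n)))).symm
    exact Nat.succ_pos _
  · rw [key, length_tagFrom, ← tagFrom_wordPrefix]
    exact congrArg _ ((omegaConcat_spec _).2 n)

theorem coverable_wfLang_of_coverable_enrich [Finite A] [Finite S] {C : OmegaClass.{u}}
    (hC : C.ClosedUnderInverseImage) {L : Set (ℕ → A)} {Ls : Multiset (Set (ℕ → A))}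
    (hL : Recognizes α L) (hLs : ∀ L' ∈ Ls, Recognizes α L')
    (h : Coverable (enrich C SU) L Ls) :
    Coverable C (wfLang α L) (Ls.map (wfLang α)) := by
  obtain ⟨K, hKfin, hKC, hcov, hsep⟩ := h
  choose W hW using fun s : imageS α => s.2
  -- a common length `k` for the members of the cover
  have hev : ∀ᶠ k in Filter.atTop, ∀ H ∈ K, ∃ (P : Set (Set (List A))) (hP : Setoid.IsPartition P)
      (_ : Finite P), (∀ X ∈ P, ∀ x y, SameSuffixes k x y → (x ∈ X ↔ y ∈ X)) ∧
        ∃ M ∈ C (P × A), H = tagging hP ⁻¹' M := by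
    rw [hKfin.eventually_all]
    intro H hH
    obtain ⟨P, hP, hPfin, hPSU, M, hM, hHM⟩ := hKC hH
    have : ∀ᶠ k in Filter.atTop, ∀ X ∈ P, ∀ x y, SameSuffixes k x y → (x ∈ X ↔ y ∈ X) := by
      rw [(Set.toFinite P).eventually_all]
      exact fun X hX => eventually_sameSuffixes_of_mem_SU (hPSU hX)
    filter_upwards [this] with k hk
    exact ⟨P, hP, hPfin, hk, M, hM, hHM⟩
  obtain ⟨k, hk⟩ := hev.exists
  choose E hE hElen using fun e : idemS α => exists_long_word e k
  let γ : (ℕ → WfAlphabet α) → ℕ → A := fun b => omegaConcat fun n => letterWord W E (b n)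
  have hval : ∀ b, α.inf (γ b) = evalOmega α b := fun b => by
    refine (α.map_infProd fun n => letterWord W E (b n)).trans ?_
    simp only [fin_letterWord hW hE, evalOmega]
  have hmem : ∀ {L' : Set (ℕ → A)}, Recognizes α L' → ∀ b, evalOmega α b ∈ α.inf '' L' →
      γ b ∈ L' := by
    rintro _ ⟨F, rfl⟩ b ⟨w, hw, hwb⟩
    change α.inf (γ b) ∈ F
    rw [hval, ← hwb]
    exact hw
  have hpull : ∀ H ∈ K, ∃ H' ∈ C (WfAlphabet α),
      ∀ b, IsWellFormed α b → (b ∈ H' ↔ γ b ∈ H) := by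
    intro H hH
    obtain ⟨P, hP, hPfin, hPk, M, hM, rfl⟩ := hk H hH
    let φ : FreeMonoid (WfAlphabet α) →* FreeMonoid (P × A) :=
      FreeMonoid.lift fun b => FreeMonoid.ofList (tagLetter hP W E b)
    refine ⟨inverseImage φ M, hC _ _ φ M hM, fun b hb => ?_⟩
    have hconc : IsInfiniteConcat (fun n => (φ (FreeMonoid.of (b n))).toList)
        (tagging hP (γ b)) := isInfiniteConcat_tagLetter hP hPk W hElen hb
    constructor
    · rintro ⟨c, hc, hc'⟩
      obtain rfl := hc'.unique hconc
      exact hc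
    · exact fun h => ⟨_, h, hconc⟩
  choose! pull hpullC hpull using hpull
  refine ⟨pull '' K, hKfin.image _, ?_, ?_, ?_⟩
  · rintro _ ⟨H, hH, rfl⟩
    exact hpullC H hH
  · rintro b ⟨hb, hbL⟩
    obtain ⟨H, hH, hbH⟩ := hcov (hmem hL b hbL)
    exact ⟨pull H, ⟨H, hH, rfl⟩, (hpull H hH b hb).2 hbH⟩
  · rintro _ ⟨H, hH, rfl⟩
    obtain ⟨L', hL', hdisj⟩ := hsep H hH
    refine ⟨wfLang α L', Multiset.mem_map_of_mem _ hL', Set.eq_empty_of_forall_notMem ?_⟩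
    rintro b ⟨hbH, hb, hbL⟩
    exact Set.eq_empty_iff_forall_notMem.1 hdisj (γ b)
      ⟨(hpull H hH b hb).1 hbH, hmem (hLs L' hL') b hbL⟩

end ToWellFormed

/-! ### The transfer theorem -/

theorem Coverable.mono {C D : OmegaClass.{u}} {A : Type u} [Finite A] (hCD : C A ⊆ D A)
    {L : Set (ℕ → A)} {Ls : Multiset (Set (ℕ → A))} (h : Coverable C L Ls) : Coverable D L Ls := by
  obtain ⟨K, h1, h2, h3⟩ := h
  exact ⟨K, h1, h2.trans hCD, h3⟩

theorem enrich_SUk_subset (C : OmegaClass.{u}) (k : ℕ) (A : Type u) [Finite A] :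
    enrich C (SUk k) A ⊆ enrich C SU A := by
  rintro _ ⟨P, hP, hPfin, hPk, L, hL, rfl⟩
  exact ⟨P, hP, hPfin, hPk.trans (SUk_subset_SU k), L, hL, rfl⟩

end OmegaEnrich

theorem theorem7p1 {A S : Type u} {T : Type v} [Finite A] [Semigroup S]
    [OmegaEnrich.OmegaSemigroup S T] [Finite S] [Finite T] (α : OmegaEnrich.OmegaHom (FreeSemigroup A) (ℕ → A) S T)
    (C : OmegaEnrich.OmegaClass.{u}) (hC : C.IsLattice) (hC' : C.ClosedUnderInverseImage)
    (L : Set (ℕ → A)) (Ls : Multiset (Set (ℕ → A)))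
    (hL : OmegaEnrich.Recognizes α L) (hLs : ∀ L' ∈ Ls, OmegaEnrich.Recognizes α L') :
    List.TFAE [
      OmegaEnrich.Coverable (OmegaEnrich.enrich C OmegaEnrich.SU) L Ls,
      OmegaEnrich.Coverable
        (OmegaEnrich.enrich C (OmegaEnrich.SUk (2 ^ (3 * Nat.card S + 1)))) L Ls,
      OmegaEnrich.Coverable C (OmegaEnrich.wfLang α L) (Ls.map (OmegaEnrich.wfLang α))] := by
  tfae_have 2 → 1 := fun h => h.mono (OmegaEnrich.enrich_SUk_subset C _ A)
  tfae_have 1 → 3 := OmegaEnrich.coverable_wfLang_of_coverable_enrich hC' hL hLs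
  tfae_have 3 → 2 := fun h => by
    rw [pow_succ']
    exact OmegaEnrich.coverable_enrich_of_coverable_wfLang hC'
      (OmegaEnrich.idemBound_two_pow α) (by positivity) h
  tfae_finish
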